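/- For real $\nu$ and $x>0$ let $$I_\nu(x)=\sum_{k=0}^\infty\frac{(x/2)^{\nu+2k}}{k!\,\Gamma(\nu+k+1)},\qquad \mathbf{L}_\nu(x)=\sum_{k=0}^\infty\frac{(x/2)^{\nu+2k+1}}{\Gamma(k+\tfrac32)\,\Gamma(k+\nu+\tfrac32)}$$ be the modified Bessel function of the first kind and the modified Struve function of the first kind (with the convention that $1/\Gamma$ is $0$ at the poles of $\Gamma$), and let $\mathrm{Ei}(y)=\mathrm{PV}\!\int_{-\infty}^{y}\frac{\mathrm{e}^{t}}{t}\,\mathrm{d}t$, $y\in\mathbb{R}\setminus\{0\}$, be the exponential integral (a Cauchy principal value at $t=0$ if $y>0$). Let $x>0$ and let $n$ be a positive integer. Then, as the real variable $\nu\neq n$ tends to $n$, the following limit exists and $$\lim_{\nu\to n}\frac{I_{\nu-1/2}(x)-\mathbf{L}_{1/2-\nu}(x)}{\sin(\pi\nu)}=\frac{2}{\pi^{3/2}}(n-1)!\Big(\frac{2}{x}\Big)^{n-1/2}\sum_{k=1}^n\binom{2n-k-1}{n-1}\frac{2^{k-2n}}{(k-1)!}\bigg\{x^{k-1}\Big[\mathrm{e}^{-x}\mathrm{Ei}(x)+(-1)^k\mathrm{e}^{x}\mathrm{Ei}(-x)\Big]-\sum_{j=1}^{k-1}(j-1)!\big[1+(-1)^{k+j}\big]x^{k-j-1}\bigg\},$$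 where an empty sum is zero. -/

import Mathlib

open Filter Topology

noncomputable section

/-- The modified Bessel function of the first kind of real order `ν`, for `x > 0`:
`I_ν(x) = (x/2)^ν ∑_{k ≥ 0} (x/2)^(2k) / (k! Γ(ν + k + 1))`.
Mathlib's `Real.Gamma` vanishes at the poles `0, -1, -2, …` of `Γ`, so the quotient is `0` there,
in agreement with the convention `1/Γ = 0` at the poles. -/
def modBesselI (ν x : ℝ) : ℝ :=
  (x / 2) ^ ν *
    ∑' k : ℕ, (x / 2) ^ (2 * k) / ((k.factorial : ℝ) * Real.Gamma (ν + (k : ℝ) + 1))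

/-- The modified Struve function of the first kind of real order `ν`, for `x > 0`:
`L_ν(x) = (x/2)^(ν+1) ∑_{k ≥ 0} (x/2)^(2k) / (Γ(k + 3/2) Γ(k + ν + 3/2))`,
with the same convention `1/Γ = 0` at the poles. -/
def modStruveL (ν x : ℝ) : ℝ :=
  (x / 2) ^ (ν + 1) *
    ∑' k : ℕ, (x / 2) ^ (2 * k) /
      (Real.Gamma ((k : ℝ) + 3 / 2) * Real.Gamma ((k : ℝ) + ν + 3 / 2))

/-- The exponential integral `Ei(x) = PV ∫_{-∞}^x e^t / t dt` for real `x ≠ 0`, where the Cauchy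
principal value is taken at the singularity `t = 0`. For `x < 0` the truncated integrals do not
depend on `ε` once `ε ≤ -x`, and the value is the ordinary integral
`∫_{-∞}^x e^t / t dt = -∫_{-x}^∞ e^(-t) / t dt`. -/
def expIntegralEi (x : ℝ) : ℝ :=
  limUnder (𝓝[>] (0 : ℝ)) fun ε : ℝ =>
    ∫ t in Set.Iic x \ Set.Ioo (-ε) ε, Real.exp t / t

end

noncomputable section

/-! At `ν = n = m + 1` the first `m` Struve terms sit at poles of `Γ` and the rest match the Bessel
series, so numerator and sine both vanish. The limit is therefore the quotient of their derivatives
in `ν`, and the work is to evaluate the order derivative of `I_{ν-1/2} - L_{1/2-ν}`.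

Put `z = x/2`, `t = z^2`. That derivative is `z^(m+1/2) * F_m(t)`, with `F_m` the
`orderDerivFactor`, and `F_m' = F_{m+1}` (`hasDerivAt_orderDerivFactor`). The finite sum `limitSum
m` of exponential integrals, divided by `z^(2m+1)`, obeys the same recurrence up to constants
(`hasDerivAt_limitSum`), so `orderDerivFactor_eq` follows by induction on `m` from the case `m = 0`.

The base case rests on `Ei(y) = log|y| + e^y W(-y)` with `W(x) = ∑ (1/Γ)'(k+1) x^k`
(`expIntegralEi_eq`). Differentiating Legendre's duplication formula turns the two
order-differentiated series into the odd part of `W` plus a multiple of `sinh`, exactly what `e^(-x)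
Ei(x) - e^x Ei(-x)` produces. -/

/-! ### Reciprocal Gamma: smoothness, recurrences and bounds. -/

/-- The reciprocal Gamma function on the real line. -/
def invGamma (s : ℝ) : ℝ := (Real.Gamma s)⁻¹

lemma invGamma_eq_re (s : ℝ) : invGamma s = ((Complex.Gamma (s : ℂ))⁻¹).re := by
  rw [Complex.Gamma_ofReal, ← Complex.ofReal_inv, Complex.ofReal_re, invGamma]

/-- Since `1/Γ` is entire, its real restriction is differentiable everywhere, including at the poles
of `Γ`. -/
lemma hasDerivAt_invGamma_re (s : ℝ) :
    HasDerivAt invGamma (deriv (fun z : ℂ => (Complex.Gamma z)⁻¹) (s : ℂ)).re s := by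
  have h := (Complex.differentiable_one_div_Gamma (s : ℂ)).hasDerivAt.real_of_complex
  exact h.congr_of_eventuallyEq (Eventually.of_forall invGamma_eq_re)

lemma hasDerivAt_invGamma (s : ℝ) : HasDerivAt invGamma (deriv invGamma s) s :=
  (hasDerivAt_invGamma_re s).differentiableAt.hasDerivAt

lemma continuous_invGamma : Continuous invGamma :=
  continuous_iff_continuousAt.2 fun s => (hasDerivAt_invGamma s).continuousAt

lemma continuous_deriv_invGamma : Continuous (deriv invGamma) := by
  have h : deriv invGamma =
      fun s : ℝ => (deriv (fun z : ℂ => (Complex.Gamma z)⁻¹) (s : ℂ)).re :=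
    funext fun s => (hasDerivAt_invGamma_re s).deriv
  rw [h]
  have h2 : Continuous (deriv fun z : ℂ => (Complex.Gamma z)⁻¹) :=
    (Complex.differentiable_one_div_Gamma.contDiff (n := 1)).continuous_deriv le_rfl
  exact Complex.continuous_re.comp (h2.comp Complex.continuous_ofReal)

lemma mul_invGamma_add_one (s : ℝ) : s * invGamma (s + 1) = invGamma s := by
  rcases eq_or_ne s 0 with rfl | hs
  · simp [invGamma, Real.Gamma_zero]
  · rw [invGamma, invGamma, Real.Gamma_add_one hs, mul_inv, mul_inv_cancel_left₀ hs]

lemma mul_deriv_invGamma_add_one (s : ℝ) :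
    s * deriv invGamma (s + 1) = deriv invGamma s - invGamma (s + 1) := by
  have h1 : HasDerivAt (fun s : ℝ => s * invGamma (s + 1))
      (1 * invGamma (s + 1) + s * deriv invGamma (s + 1)) s :=
    (hasDerivAt_id s).mul ((hasDerivAt_invGamma (s + 1)).comp_add_const s 1)
  rw [funext mul_invGamma_add_one] at h1
  linarith [h1.deriv]

lemma invGamma_natCast_add_one (k : ℕ) : invGamma ((k : ℝ) + 1) = (k.factorial : ℝ)⁻¹ := by
  rw [invGamma, Real.Gamma_nat_eq_factorial]

lemma invGamma_neg_natCast (k : ℕ) : invGamma (-(k : ℝ)) = 0 := by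
  rw [invGamma, Real.Gamma_neg_nat_eq_zero, inv_zero]

lemma invGamma_mul_invGamma_add_half (s : ℝ) :
    invGamma s * invGamma (s + 1 / 2) =
      invGamma (2 * s) * ((2 : ℝ) ^ (2 * s - 1) / √Real.pi) := by
  rw [invGamma, invGamma, invGamma, ← mul_inv, Real.Gamma_mul_Gamma_add_half, mul_inv, mul_inv,
    ← Real.rpow_neg zero_le_two, neg_sub, mul_assoc, div_eq_mul_inv]

/-- Compactness covers `[a, max a 3]`. Beyond it, bounds on `[2, 3]` propagate one unit at a time:
the recurrences give at most `2C / (s - 1)`, and `s - 1 ≥ 2`. -/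
lemma exists_bound_invGamma (a : ℝ) :
    ∃ C : ℝ, 0 < C ∧ ∀ s, a ≤ s → |invGamma s| ≤ C ∧ |deriv invGamma s| ≤ C := by
  obtain ⟨C₁, hC₁⟩ := (isCompact_Icc (a := a) (b := max a 3)).exists_bound_of_continuousOn
    continuous_invGamma.continuousOn
  obtain ⟨C₂, hC₂⟩ := (isCompact_Icc (a := a) (b := max a 3)).exists_bound_of_continuousOn
    continuous_deriv_invGamma.continuousOn
  obtain ⟨C₃, hC₃⟩ := (isCompact_Icc (a := (2 : ℝ)) (b := 3)).exists_bound_of_continuousOn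
    continuous_invGamma.continuousOn
  obtain ⟨C₄, hC₄⟩ := (isCompact_Icc (a := (2 : ℝ)) (b := 3)).exists_bound_of_continuousOn
    continuous_deriv_invGamma.continuousOn
  obtain ⟨C, hC0, h1, h2, h3, h4⟩ : ∃ C : ℝ, 0 < C ∧ C₁ ≤ C ∧ C₂ ≤ C ∧ C₃ ≤ C ∧ C₄ ≤ C := by
    refine ⟨|C₁| + |C₂| + |C₃| + |C₄| + 1, by positivity, ?_, ?_, ?_, ?_⟩ <;>
    linarith [le_abs_self C₁, le_abs_self C₂, le_abs_self C₃, le_abs_self C₄, abs_nonneg C₁,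
      abs_nonneg C₂, abs_nonneg C₃, abs_nonneg C₄]
  have key : ∀ m : ℕ, ∀ s : ℝ, 2 ≤ s → s ≤ m + 3 → |invGamma s| ≤ C ∧ |deriv invGamma s| ≤ C := by
    intro m
    induction m with
    | zero =>
      intro s hs hs'
      have hs' : s ∈ Set.Icc (2 : ℝ) 3 := ⟨hs, by simpa using hs'⟩
      exact ⟨(hC₃ s hs').trans h3, (hC₄ s hs').trans h4⟩
    | succ m ih =>
      intro s hs hs'
      by_cases h : s ≤ m + 3
      · exact ih s hs h
      · push Not at h
        push_cast at hs'
        have hm : (0 : ℝ) ≤ m := m.cast_nonneg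
        obtain ⟨i1, i2⟩ := ih (s - 1) (by linarith) (by linarith)
        have e1 := mul_invGamma_add_one (s - 1)
        have e2 := mul_deriv_invGamma_add_one (s - 1)
        rw [sub_add_cancel] at e1 e2
        have a1 : (s - 1) * |invGamma s| ≤ C := by
          rw [← abs_of_pos (show 0 < s - 1 by linarith), ← abs_mul, e1]; exact i1
        have a2 : (s - 1) * |deriv invGamma s| ≤ C + |invGamma s| := by
          rw [← abs_of_pos (show 0 < s - 1 by linarith), ← abs_mul, e2]
          exact (abs_sub _ _).trans (by linarith)
        have b1 : |invGamma s| ≤ C := by nlinarith [abs_nonneg (invGamma s)]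
        exact ⟨b1, by nlinarith [abs_nonneg (deriv invGamma s)]⟩
  refine ⟨C, hC0, fun s hs => ?_⟩
  by_cases h : s ≤ max a 3
  · exact ⟨(hC₁ s ⟨hs, h⟩).trans h1, (hC₂ s ⟨hs, h⟩).trans h2⟩
  · push Not at h
    have h3' : 3 < s := (le_max_right a 3).trans_lt h
    obtain ⟨m, hm⟩ := exists_nat_ge s
    exact key m s (by linarith) (by linarith)

lemma abs_invGamma_natCast_add_three_halves_le (k : ℕ) :
    |invGamma ((k : ℝ) + 3 / 2)| ≤ |invGamma (3 / 2)| / k.factorial := by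
  induction k with
  | zero => simp
  | succ k ih =>
    have e := mul_invGamma_add_one ((k : ℝ) + 3 / 2)
    rw [show ((k + 1 : ℕ) : ℝ) + 3 / 2 = (k : ℝ) + 3 / 2 + 1 by push_cast; ring]
    have hk : (0 : ℝ) ≤ k := k.cast_nonneg
    rw [← e, abs_mul, abs_of_pos (by linarith : (0 : ℝ) < k + 3 / 2)] at ih
    rw [Nat.factorial_succ, le_div_iff₀ (by positivity)]
    rw [le_div_iff₀ (by positivity)] at ih
    refine le_trans (le_of_eq_of_le ?_ (mul_le_mul_of_nonneg_right (mul_le_mul_of_nonneg_right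
      (by linarith : (k : ℝ) + 1 ≤ k + 3 / 2) (abs_nonneg (invGamma ((k : ℝ) + 3 / 2 + 1))))
      (by positivity : (0 : ℝ) ≤ k.factorial))) ih
    push_cast
    ring

/-! ### Power series with `O(1/k!)` coefficients. -/

/-- A sequence is `O(1 / k!)`. -/
def FactorialBounded (a : ℕ → ℝ) : Prop := ∃ C : ℝ, ∀ k, |a k| ≤ C / k.factorial

lemma FactorialBounded.summable {a : ℕ → ℝ} (ha : FactorialBounded a) (t : ℝ) :
    Summable fun k => a k * t ^ k := by
  obtain ⟨C, hC⟩ := ha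
  refine Summable.of_norm_bounded ((Real.summable_pow_div_factorial |t|).mul_left C) fun k => ?_
  rw [Real.norm_eq_abs, abs_mul, abs_pow]
  exact (mul_le_mul_of_nonneg_right (hC k) (by positivity)).trans_eq (by ring)

lemma summable_nat_mul_pow_pred_div_factorial (t : ℝ) :
    Summable fun k : ℕ => (k : ℝ) * t ^ (k - 1) / k.factorial := by
  rw [← summable_nat_add_iff 1]
  refine (Real.summable_pow_div_factorial t).congr fun k => ?_
  rw [Nat.factorial_succ]
  have : (k.factorial : ℝ) ≠ 0 := by positivity
  push_cast
  field_simp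

lemma FactorialBounded.summable_deriv {a : ℕ → ℝ} (ha : FactorialBounded a) (t : ℝ) :
    Summable fun k : ℕ => a k * (k * t ^ (k - 1)) := by
  obtain ⟨C, hC⟩ := ha
  refine Summable.of_norm_bounded
    ((summable_nat_mul_pow_pred_div_factorial |t|).mul_left C) fun k => ?_
  rw [Real.norm_eq_abs, abs_mul, abs_mul, abs_pow, Nat.abs_cast]
  exact (mul_le_mul_of_nonneg_right (hC k) (by positivity)).trans_eq (by ring)

lemma FactorialBounded.hasDerivAt {a : ℕ → ℝ} (ha : FactorialBounded a) (t : ℝ) :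
    HasDerivAt (fun t => ∑' k, a k * t ^ k) (∑' k : ℕ, a k * (k * t ^ (k - 1))) t := by
  obtain ⟨C, hC⟩ := id ha
  refine hasDerivAt_tsum_of_isPreconnected (t := Metric.ball 0 (|t| + 1)) (y₀ := 0)
    (u := fun k : ℕ => C * ((k : ℝ) * (|t| + 1) ^ (k - 1) / k.factorial))
    ((summable_nat_mul_pow_pred_div_factorial _).mul_left C) Metric.isOpen_ball
    (convex_ball _ _).isPreconnected
    (fun k y _ => (hasDerivAt_pow k y).const_mul (a k)) (fun k y hy => ?_)
    (Metric.mem_ball_self (by positivity)) (ha.summable 0) (by simp)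
  rw [Real.norm_eq_abs, abs_mul, abs_mul, abs_pow, Nat.abs_cast]
  rw [mem_ball_zero_iff, Real.norm_eq_abs] at hy
  have h : |y| ^ (k - 1) ≤ (|t| + 1) ^ (k - 1) := pow_le_pow_left₀ (abs_nonneg y) hy.le _
  calc |a k| * (k * |y| ^ (k - 1)) ≤ C / k.factorial * (k * (|t| + 1) ^ (k - 1)) :=
        mul_le_mul (hC k) (mul_le_mul_of_nonneg_left h k.cast_nonneg) (by positivity)
          ((abs_nonneg _).trans (hC k))
    _ = _ := by ring

lemma FactorialBounded.hasDerivAt_shift {a : ℕ → ℝ} (ha : FactorialBounded a) (t : ℝ) :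
    HasDerivAt (fun t => ∑' k, a k * t ^ k) (∑' k : ℕ, ((k : ℝ) + 1) * a (k + 1) * t ^ k) t := by
  convert! ha.hasDerivAt t using 1
  rw [(ha.summable_deriv t).tsum_eq_zero_add]
  simp only [Nat.cast_zero, zero_mul, mul_zero, zero_add, Nat.cast_add, Nat.cast_one,
    Nat.add_sub_cancel]
  exact tsum_congr fun k => by ring

lemma mul_tsum_deriv (a : ℕ → ℝ) (t : ℝ) :
    t * ∑' k : ℕ, a k * (k * t ^ (k - 1)) = ∑' k : ℕ, k * a k * t ^ k := by
  rw [← tsum_mul_left]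
  refine tsum_congr fun k => ?_
  rcases k with _ | k
  · simp
  · rw [Nat.add_sub_cancel, pow_succ]; ring

/-! ### Bessel and Struve series and their derivatives in the order. -/

/-- Coefficients of the Bessel series, with `f` in place of the reciprocal Gamma function. -/
def besselCoeff (f : ℝ → ℝ) (ν : ℝ) (k : ℕ) : ℝ := f (ν + k + 1 / 2) / k.factorial

/-- Coefficients of the Struve series, with `f` in place of one reciprocal Gamma function. -/
def struveCoeff (f : ℝ → ℝ) (ν : ℝ) (k : ℕ) : ℝ := invGamma (k + 3 / 2) * f (k + 2 - ν)

lemma factorialBounded_besselCoeff (ν : ℝ) : FactorialBounded (besselCoeff invGamma ν) := by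
  obtain ⟨C, -, hC⟩ := exists_bound_invGamma (ν + 1 / 2)
  refine ⟨C, fun k => ?_⟩
  rw [besselCoeff, abs_div, Nat.abs_cast]
  have hk : (0 : ℝ) ≤ k := k.cast_nonneg
  have := (hC (ν + k + 1 / 2) (by linarith)).1
  gcongr

lemma factorialBounded_besselCoeff_deriv (ν : ℝ) :
    FactorialBounded (besselCoeff (deriv invGamma) ν) := by
  obtain ⟨C, -, hC⟩ := exists_bound_invGamma (ν + 1 / 2)
  refine ⟨C, fun k => ?_⟩
  rw [besselCoeff, abs_div, Nat.abs_cast]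
  have hk : (0 : ℝ) ≤ k := k.cast_nonneg
  have := (hC (ν + k + 1 / 2) (by linarith)).2
  gcongr

lemma abs_struveCoeff_le {f : ℝ → ℝ} {ν C : ℝ} {k : ℕ} (h : |f (k + 2 - ν)| ≤ C) :
    |struveCoeff f ν k| ≤ |invGamma (3 / 2)| * C / k.factorial := by
  rw [struveCoeff, abs_mul, mul_div_right_comm]
  exact mul_le_mul (abs_invGamma_natCast_add_three_halves_le k) h (abs_nonneg _) (by positivity)

lemma factorialBounded_struveCoeff (ν : ℝ) : FactorialBounded (struveCoeff invGamma ν) := by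
  obtain ⟨C, -, hC⟩ := exists_bound_invGamma (2 - ν)
  refine ⟨_, fun k => abs_struveCoeff_le (hC _ ?_).1⟩
  have hk : (0 : ℝ) ≤ k := k.cast_nonneg
  linarith

lemma factorialBounded_struveCoeff_deriv (ν : ℝ) :
    FactorialBounded (struveCoeff (deriv invGamma) ν) := by
  obtain ⟨C, -, hC⟩ := exists_bound_invGamma (2 - ν)
  refine ⟨_, fun k => abs_struveCoeff_le (hC _ ?_).2⟩
  have hk : (0 : ℝ) ≤ k := k.cast_nonneg
  linarith

lemma hasDerivAt_order_tsum_besselCoeff (ν t : ℝ) :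
    HasDerivAt (fun ν => ∑' k, besselCoeff invGamma ν k * t ^ k)
      (∑' k, besselCoeff (deriv invGamma) ν k * t ^ k) ν := by
  obtain ⟨C, hC0, hC⟩ := exists_bound_invGamma (ν - 1 / 2)
  refine hasDerivAt_tsum_of_isPreconnected (t := Set.Ioo (ν - 1) (ν + 1)) (y₀ := ν)
    (u := fun k : ℕ => C * (|t| ^ k / k.factorial))
    ((Real.summable_pow_div_factorial _).mul_left C) isOpen_Ioo isPreconnected_Ioo
    (g := fun k ν => besselCoeff invGamma ν k * t ^ k)
    (g' := fun k ν => besselCoeff (deriv invGamma) ν k * t ^ k)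
    (fun k y _ => ?_) (fun k y hy => ?_) (by simp) ((factorialBounded_besselCoeff ν).summable t)
    (by simp)
  · have h := (hasDerivAt_invGamma (y + (k + 1 / 2))).comp_add_const y (k + 1 / 2)
    simp only [besselCoeff, add_assoc]
    exact (h.div_const (k.factorial : ℝ)).mul_const (t ^ k)
  · have hk : (0 : ℝ) ≤ k := k.cast_nonneg
    have h := (hC (y + k + 1 / 2) (by linarith [hy.1])).2
    rw [Real.norm_eq_abs, abs_mul, abs_pow, besselCoeff, abs_div, Nat.abs_cast]
    calc _ ≤ C / k.factorial * |t| ^ k := by gcongr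
      _ = _ := by ring

lemma hasDerivAt_order_tsum_struveCoeff (ν t : ℝ) :
    HasDerivAt (fun ν => ∑' k, struveCoeff invGamma ν k * t ^ k)
      (-∑' k, struveCoeff (deriv invGamma) ν k * t ^ k) ν := by
  obtain ⟨C, hC0, hC⟩ := exists_bound_invGamma (1 - ν)
  rw [← tsum_neg]
  refine hasDerivAt_tsum_of_isPreconnected (t := Set.Ioo (ν - 1) (ν + 1)) (y₀ := ν)
    (u := fun k : ℕ => |invGamma (3 / 2)| * C * (|t| ^ k / k.factorial))
    ((Real.summable_pow_div_factorial _).mul_left _) isOpen_Ioo isPreconnected_Ioo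
    (g' := fun k ν => -(struveCoeff (deriv invGamma) ν k * t ^ k))
    (fun k y _ => ?_) (fun k y hy => ?_) (by simp) ((factorialBounded_struveCoeff ν).summable t)
    (by simp)
  · have h := (hasDerivAt_invGamma (k + 2 - y)).comp_const_sub (k + 2 : ℝ) y
    convert! (h.const_mul (invGamma (k + 3 / 2))).mul_const (t ^ k) using 1
    rw [struveCoeff]; ring
  · have hk : (0 : ℝ) ≤ k := k.cast_nonneg
    have h := abs_struveCoeff_le (hC (k + 2 - y) (by linarith [hy.2])).2
    rw [norm_neg, Real.norm_eq_abs, abs_mul, abs_pow]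
    calc _ ≤ |invGamma (3 / 2)| * C / k.factorial * |t| ^ k := by gcongr
      _ = _ := by ring

lemma modBesselI_eq (ν x : ℝ) :
    modBesselI (ν - 1 / 2) x =
      (x / 2) ^ (ν - 1 / 2) * ∑' k, besselCoeff invGamma ν k * ((x / 2) ^ 2) ^ k := by
  rw [modBesselI]
  congr 1
  refine tsum_congr fun k => ?_
  rw [besselCoeff, invGamma, pow_mul, show ν - 1 / 2 + k + 1 = ν + k + 1 / 2 by ring,
    div_eq_mul_inv, mul_inv]
  ring

lemma modStruveL_eq (ν x : ℝ) :
    modStruveL (1 / 2 - ν) x =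
      (x / 2) ^ (3 / 2 - ν) * ∑' k, struveCoeff invGamma ν k * ((x / 2) ^ 2) ^ k := by
  rw [modStruveL, show 1 / 2 - ν + 1 = 3 / 2 - ν by ring]
  congr 1
  refine tsum_congr fun k => ?_
  rw [struveCoeff, invGamma, invGamma, pow_mul,
    show (k : ℝ) + (1 / 2 - ν) + 3 / 2 = k + 2 - ν by ring, div_eq_mul_inv, mul_inv]
  ring

/-- For `k < m` the factor `1/Γ(k + 1 - m)` is at a pole of `Γ` and vanishes; shifting the index by
`m` turns the other terms into Bessel terms. -/
lemma tsum_struveCoeff_natCast (m : ℕ) (t : ℝ) :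
    ∑' k, struveCoeff invGamma (m + 1) k * t ^ k =
      t ^ m * ∑' k, besselCoeff invGamma (m + 1) k * t ^ k := by
  rw [← ((factorialBounded_struveCoeff _).summable t).sum_add_tsum_nat_add m,
    Finset.sum_eq_zero fun k hk => ?_, zero_add, ← tsum_mul_left]
  · refine tsum_congr fun k => ?_
    rw [struveCoeff, besselCoeff, div_eq_mul_inv (invGamma _), ← invGamma_natCast_add_one]
    push_cast
    rw [show (k : ℝ) + m + 2 - (m + 1) = k + 1 by ring,
      show (m : ℝ) + 1 + k + 1 / 2 = k + m + 3 / 2 by ring]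
    ring
  · obtain ⟨j, rfl⟩ := Nat.exists_eq_add_of_lt (Finset.mem_range.1 hk)
    rw [struveCoeff, show (k : ℝ) + 2 - ((k + j + 1 : ℕ) + 1) = -(j : ℝ) by push_cast; ring,
      invGamma_neg_natCast]
    ring

lemma add_one_mul_besselCoeff_succ (f : ℝ → ℝ) (ν : ℝ) (k : ℕ) :
    ((k : ℝ) + 1) * besselCoeff f ν (k + 1) = besselCoeff f (ν + 1) k := by
  rw [besselCoeff, besselCoeff, Nat.factorial_succ]
  push_cast
  rw [show ν + ((k : ℝ) + 1) + 1 / 2 = ν + 1 + k + 1 / 2 by ring]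
  have : (k.factorial : ℝ) ≠ 0 := by positivity
  field_simp

lemma mul_struveCoeff_deriv (ν : ℝ) (k : ℕ) :
    ((k : ℝ) + 1 - ν) * struveCoeff (deriv invGamma) ν k =
      struveCoeff (deriv invGamma) (ν + 1) k - struveCoeff invGamma ν k := by
  have h := mul_deriv_invGamma_add_one ((k : ℝ) + 1 - ν)
  rw [struveCoeff, struveCoeff, struveCoeff, show (k : ℝ) + 2 - ν = k + 1 - ν + 1 by ring,
    show (k : ℝ) + 2 - (ν + 1) = k + 1 - ν by ring, mul_left_comm, h]
  ring

/-! ### The order derivative and its recurrence in `t`. -/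

/-- The regular factor of the derivative in `ν` of `I_{ν-1/2} - L_{1/2-ν}` at `ν = m + 1`, as a
function of `t = (x/2)^2`. -/
def orderDerivFactor (m : ℕ) (t : ℝ) : ℝ :=
  Real.log t * (∑' k, besselCoeff invGamma (m + 1) k * t ^ k) +
    (∑' k, besselCoeff (deriv invGamma) (m + 1) k * t ^ k) +
    (∑' k, struveCoeff (deriv invGamma) (m + 1) k * t ^ k) / t ^ m

/-- Differentiating either Bessel series in `t` raises the order by one. The term `1/t` from the
logarithm is cancelled by the undifferentiated Struve series that the recurrence of `(1/Γ)'` leaves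
behind. -/
lemma hasDerivAt_orderDerivFactor (m : ℕ) {t : ℝ} (ht : t ≠ 0) :
    HasDerivAt (orderDerivFactor m) (orderDerivFactor (m + 1) t) t := by
  have hA := (factorialBounded_besselCoeff (m + 1)).hasDerivAt_shift t
  have hA' := (factorialBounded_besselCoeff_deriv (m + 1)).hasDerivAt_shift t
  have hB := (factorialBounded_struveCoeff_deriv (m + 1)).hasDerivAt t
  have hB1 := mul_tsum_deriv (struveCoeff (deriv invGamma) (m + 1)) t
  -- Write `k = m + (k - m)`; the factor `k - m` is the one absorbed by `mul_struveCoeff_deriv`.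
  have hrec : ∑' k : ℕ, k * struveCoeff (deriv invGamma) (m + 1) k * t ^ k =
      m * (∑' k, struveCoeff (deriv invGamma) (m + 1) k * t ^ k) +
      (∑' k, struveCoeff (deriv invGamma) (m + 1 + 1) k * t ^ k) -
      ∑' k, struveCoeff invGamma (m + 1) k * t ^ k := by
    have s1 := (factorialBounded_struveCoeff_deriv (m + 1)).summable t
    have s2 := (factorialBounded_struveCoeff_deriv (m + 1 + 1)).summable t
    have s3 := (factorialBounded_struveCoeff (m + 1)).summable t
    rw [← tsum_mul_left, ← (s1.mul_left _).tsum_add s2, ← ((s1.mul_left _).add s2).tsum_sub s3]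
    refine tsum_congr fun k => ?_
    linear_combination t ^ k * mul_struveCoeff_deriv (m + 1) k
  rw [tsum_struveCoeff_natCast] at hrec
  simp only [add_one_mul_besselCoeff_succ] at hA hA'
  convert! (((Real.hasDerivAt_log ht).mul hA).add hA').add
    (hB.div (hasDerivAt_pow m t) (pow_ne_zero m ht)) using 1
  rw [orderDerivFactor]
  push_cast
  set S := ∑' k : ℕ, struveCoeff (deriv invGamma) (m + 1) k * (k * t ^ (k - 1))
  have hS : S = (m * (∑' k, struveCoeff (deriv invGamma) (m + 1) k * t ^ k) +
      (∑' k, struveCoeff (deriv invGamma) (m + 1 + 1) k * t ^ k) -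
      t ^ m * ∑' k, besselCoeff invGamma (m + 1) k * t ^ k) / t := by
    rw [eq_div_iff ht, ← hrec, ← hB1]; ring
  have hm : (m : ℝ) * t ^ (m - 1) = m * t ^ m / t := by
    rcases m with _ | m
    · simp
    · rw [Nat.add_sub_cancel, pow_succ]; field_simp
  rw [hS, hm]
  field_simp
  ring

lemma modBesselI_eq_modStruveL (m : ℕ) {x : ℝ} (hx : 0 < x) :
    modBesselI ((m + 1 : ℝ) - 1 / 2) x = modStruveL (1 / 2 - (m + 1 : ℝ)) x := by
  have hz : 0 < x / 2 := by positivity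
  rw [modBesselI_eq, modStruveL_eq, tsum_struveCoeff_natCast, ← mul_assoc]
  congr 1
  rw [← pow_mul, ← Real.rpow_natCast, ← Real.rpow_add hz]
  congr 1
  push_cast
  ring

/-- The exponents of the two prefactors move in opposite directions with `ν`, so their logarithms
add up to `2 log z = log t`. -/
lemma hasDerivAt_order_sub (m : ℕ) {x : ℝ} (hx : 0 < x) :
    HasDerivAt (fun ν => modBesselI (ν - 1 / 2) x - modStruveL (1 / 2 - ν) x)
      ((x / 2) ^ (m + 1 / 2 : ℝ) * orderDerivFactor m ((x / 2) ^ 2)) (m + 1) := by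
  have hz : 0 < x / 2 := by positivity
  simp only [modBesselI_eq, modStruveL_eq]
  set z := x / 2
  have h1 : HasDerivAt (fun ν : ℝ => z ^ (ν - 1 / 2))
      (Real.log z * 1 * z ^ ((m + 1 : ℝ) - 1 / 2)) (m + 1 : ℝ) :=
    ((hasDerivAt_id (m + 1 : ℝ)).sub_const (1 / 2)).const_rpow hz
  have h2 : HasDerivAt (fun ν : ℝ => z ^ (3 / 2 - ν))
      (Real.log z * (-1) * z ^ (3 / 2 - (m + 1 : ℝ))) (m + 1 : ℝ) :=
    ((hasDerivAt_id (m + 1 : ℝ)).const_sub (3 / 2)).const_rpow hz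
  convert! (h1.mul (hasDerivAt_order_tsum_besselCoeff (m + 1) (z ^ 2))).sub
    (h2.mul (hasDerivAt_order_tsum_struveCoeff (m + 1) (z ^ 2))) using 1
  have e2 : z ^ (3 / 2 - (m + 1 : ℝ)) = z ^ (m + 1 / 2 : ℝ) / (z ^ 2) ^ m := by
    rw [← pow_mul, ← Real.rpow_natCast, ← Real.rpow_sub hz]
    congr 1; push_cast; ring
  rw [tsum_struveCoeff_natCast, e2, show (m + 1 : ℝ) - 1 / 2 = m + 1 / 2 by ring,
    orderDerivFactor, Real.log_pow]
  push_cast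
  field_simp
  ring

/-! ### The generating function of `(1/Γ)'` at positive integers. -/

open MeasureTheory in
lemma integrableOn_exp_neg_mul_log :
    IntegrableOn (fun t : ℝ => Real.exp (-t) * Real.log t) (Set.Ioi 0) := by
  -- Majorant `2 t^(-1/2) + t` of `|log t|`: the first term serves near `0`, the second at infinity.
  have h1 := (Real.GammaIntegral_convergent (s := 1 / 2) (by norm_num)).const_mul 2
  have h2 := Real.GammaIntegral_convergent (s := 2) (by norm_num)
  refine Integrable.mono' (h1.add h2) (by fun_prop) ?_
  filter_upwards [ae_restrict_mem measurableSet_Ioi] with t (ht : 0 < t)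
  have e1 : Real.log t ≤ t := (Real.log_le_sub_one_of_pos ht).trans (by linarith)
  have e2 := Real.log_le_rpow_div (inv_nonneg.2 ht.le) (ε := 1 / 2) (by norm_num)
  rw [Real.log_inv, Real.inv_rpow ht.le, ← Real.rpow_neg ht.le] at e2
  have e3 : 0 ≤ t ^ (-(1 / 2) : ℝ) := by positivity
  rw [Real.norm_eq_abs, abs_mul, abs_of_pos (Real.exp_pos _), Pi.add_apply,
    show (1 / 2 - 1 : ℝ) = -(1 / 2) by norm_num, show (2 - 1 : ℝ) = 1 by norm_num, Real.rpow_one]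
  have : |Real.log t| ≤ 2 * t ^ (-(1 / 2) : ℝ) + t := by
    rw [abs_le]; constructor <;> linarith
  calc _ ≤ Real.exp (-t) * (2 * t ^ (-(1 / 2) : ℝ) + t) := by gcongr
    _ = _ := by ring

lemma deriv_invGamma_one :
    deriv invGamma 1 = -∫ t in Set.Ioi (0 : ℝ), Real.exp (-t) * Real.log t := by
  have h1 := Complex.hasDerivAt_GammaIntegral (s := 1) (by simp)
  have h2 : HasDerivAt Complex.Gamma
      ((∫ t in Set.Ioi (0 : ℝ), Real.exp (-t) * Real.log t : ℝ) : ℂ) ((1 : ℝ) : ℂ) := by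
    rw [Complex.ofReal_one]
    convert! h1.congr_of_eventuallyEq (f₁ := Complex.Gamma) ?_ using 1
    · rw [← integral_complex_ofReal]
      congr 1
      funext t
      push_cast
      rw [sub_self, Complex.cpow_zero]
      ring
    · filter_upwards [(isOpen_lt continuous_const Complex.continuous_re).mem_nhds
        (show (0 : ℝ) < (1 : ℂ).re by simp)] with s hs
      exact Complex.Gamma_eq_integral hs
  have h3 : HasDerivAt Real.Gamma (∫ t in Set.Ioi (0 : ℝ), Real.exp (-t) * Real.log t) 1 :=
    h2.real_of_complex
  have h4 := (h3.inv (by simp)).deriv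
  rw [Real.Gamma_one] at h4
  rw [show invGamma = Real.Gamma⁻¹ from rfl, h4]
  ring

/-- The generating function of `(1 / Γ)'` at the positive integers. -/
def invGammaDerivSeries (x : ℝ) : ℝ := ∑' k : ℕ, deriv invGamma (k + 1) * x ^ k

lemma add_one_mul_deriv_invGamma (k : ℕ) :
    ((k : ℝ) + 1) * deriv invGamma ((k + 1 : ℕ) + 1) =
      deriv invGamma (k + 1) - ((k + 1).factorial : ℝ)⁻¹ := by
  have h := mul_deriv_invGamma_add_one ((k : ℝ) + 1)
  have h2 := invGamma_natCast_add_one (k + 1)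
  push_cast at h2 ⊢
  rw [h, h2]

lemma abs_deriv_invGamma_natCast_le (k : ℕ) :
    |deriv invGamma (k + 1)| ≤ (|deriv invGamma 1| + k) / k.factorial := by
  induction k with
  | zero => simp
  | succ k ih =>
    have h := add_one_mul_deriv_invGamma k
    have hf : (0 : ℝ) < k.factorial := by positivity
    have hk : (0 : ℝ) ≤ k := k.cast_nonneg
    have h3 : ((k : ℝ) + 1) * |deriv invGamma ((k + 1 : ℕ) + 1)| ≤
        (|deriv invGamma 1| + k) / k.factorial + ((k + 1).factorial : ℝ)⁻¹ := by
      rw [← abs_of_pos (show (0 : ℝ) < k + 1 by linarith), ← abs_mul, h]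
      refine (abs_sub _ _).trans (add_le_add ih ?_)
      rw [abs_of_pos (by positivity)]
    have h4 : (((k + 1).factorial : ℕ) : ℝ)⁻¹ ≤ 1 / k.factorial := by
      rw [Nat.factorial_succ, one_div]
      push_cast
      gcongr
      nlinarith
    rw [Nat.factorial_succ, le_div_iff₀ (by positivity)]
    have h5 : ((k : ℝ) + 1) * |deriv invGamma ((k + 1 : ℕ) + 1)| ≤
        (|deriv invGamma 1| + k + 1) / k.factorial := by
      rw [add_div (|deriv invGamma 1| + k)]; linarith
    rw [le_div_iff₀ hf] at h5
    push_cast at h5 ⊢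
    linarith

/-- The available bound is only `O(k/k!)`; the factor `2^k` absorbs the `k`, at the cost of working
with the variable `2x`. -/
lemma factorialBounded_deriv_invGamma :
    FactorialBounded fun k => deriv invGamma (k + 1) / 2 ^ k := by
  refine ⟨|deriv invGamma 1| + 1, fun k => ?_⟩
  rw [abs_div, abs_of_pos (by positivity : (0 : ℝ) < 2 ^ k), div_le_iff₀ (by positivity)]
  refine (abs_deriv_invGamma_natCast_le k).trans ?_
  rw [div_mul_eq_mul_div]
  have h1 : (k : ℝ) ≤ 2 ^ k := by exact_mod_cast Nat.lt_two_pow_self.le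
  have h2 : (1 : ℝ) ≤ 2 ^ k := one_le_pow₀ one_le_two
  gcongr
  nlinarith [abs_nonneg (deriv invGamma 1)]

lemma summable_deriv_invGamma (x : ℝ) : Summable fun k : ℕ => deriv invGamma (k + 1) * x ^ k := by
  refine (factorialBounded_deriv_invGamma.summable (2 * x)).congr fun k => ?_
  rw [mul_pow]
  field_simp

lemma invGammaDerivSeries_eq (x : ℝ) :
    invGammaDerivSeries x = ∑' k : ℕ, deriv invGamma (k + 1) / 2 ^ k * (2 * x) ^ k := by
  refine tsum_congr fun k => ?_
  rw [mul_pow]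
  field_simp

lemma hasSum_pow_succ_div_factorial (x : ℝ) :
    HasSum (fun k : ℕ => x ^ (k + 1) / (k + 1).factorial) (Real.exp x - 1) := by
  have h := NormedSpace.expSeries_div_hasSum_exp (𝔸 := ℝ) x
  rw [← Real.exp_eq_exp_ℝ, ← hasSum_nat_add_iff' 1] at h
  simpa using h

lemma hasDerivAt_invGammaDerivSeries {x : ℝ} (hx : x ≠ 0) :
    HasDerivAt invGammaDerivSeries (invGammaDerivSeries x - (Real.exp x - 1) / x) x := by
  have h := (factorialBounded_deriv_invGamma.hasDerivAt_shift (2 * x)).comp x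
    ((hasDerivAt_id x).const_mul 2)
  have h' := h.congr_of_eventuallyEq (Eventually.of_forall invGammaDerivSeries_eq)
  convert! h' using 1
  rw [mul_one, ← tsum_mul_right, invGammaDerivSeries,
    ← (hasSum_pow_succ_div_factorial x).tsum_eq, ← tsum_div_const,
    ← (summable_deriv_invGamma x).tsum_sub ((hasSum_pow_succ_div_factorial x).summable.div_const x)]
  refine tsum_congr fun k => ?_
  have h1 := add_one_mul_deriv_invGamma k
  have h2 : deriv invGamma (k + 1) =
    (k + 1) * deriv invGamma ((k + 1 : ℕ) + 1) + ((k + 1).factorial : ℝ)⁻¹ := by linarith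
  rw [h2, mul_pow, pow_succ, pow_succ]
  field_simp
  ring

lemma continuous_invGammaDerivSeries : Continuous invGammaDerivSeries := by
  rw [funext invGammaDerivSeries_eq]
  exact (continuous_iff_continuousAt.2 fun t =>
    (factorialBounded_deriv_invGamma.hasDerivAt t).continuousAt).comp (continuous_const_mul 2)

lemma invGammaDerivSeries_zero : invGammaDerivSeries 0 = deriv invGamma 1 := by
  rw [invGammaDerivSeries, tsum_eq_single 0 fun k hk => by simp [hk]]
  simp

/-! ### Closed form of the exponential integral. -/

/-- A closed form of the exponential integral. -/
def expIntegralSeries (y : ℝ) : ℝ := Real.log y + Real.exp y * invGammaDerivSeries (-y)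

lemma hasDerivAt_expIntegralSeries {y : ℝ} (hy : y ≠ 0) :
    HasDerivAt expIntegralSeries (Real.exp y / y) y := by
  have h := (Real.hasDerivAt_log hy).add ((Real.hasDerivAt_exp y).mul
    ((hasDerivAt_invGammaDerivSeries (neg_ne_zero.2 hy)).comp y (hasDerivAt_neg y)))
  convert! h using 1
  rw [Function.comp_apply, Real.exp_neg]
  have := Real.exp_ne_zero y
  field_simp
  ring

open MeasureTheory in
lemma integrableOn_exp_neg_div {a : ℝ} (ha : 0 < a) :
    IntegrableOn (fun t : ℝ => Real.exp (-t) / t) (Set.Ioi a) := by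
  refine Integrable.mono' ((integrableOn_exp_neg_Ioi a).div_const a)
    (Measurable.aestronglyMeasurable (by fun_prop)) ?_
  filter_upwards [ae_restrict_mem measurableSet_Ioi] with t (ht : a < t)
  rw [Real.norm_eq_abs, abs_of_pos (div_pos (Real.exp_pos _) (ha.trans ht))]
  gcongr

open MeasureTheory in
lemma integral_exp_neg_div_by_parts {a : ℝ} (ha : 0 < a) :
    ∫ t in Set.Ioi a, Real.exp (-t) / t =
      (∫ t in Set.Ioi a, Real.exp (-t) * Real.log t) - Real.exp (-a) * Real.log a := by
  have i1 := integrableOn_exp_neg_div ha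
  have i2 : IntegrableOn (fun t : ℝ => Real.exp (-t) * Real.log t) (Set.Ioi a) :=
    integrableOn_exp_neg_mul_log.mono_set (Set.Ioi_subset_Ioi ha.le)
  have hd : ∀ t ∈ Set.Ici a, HasDerivAt (fun t : ℝ => Real.exp (-t) * Real.log t)
      (Real.exp (-t) / t - Real.exp (-t) * Real.log t) t := by
    intro t ht
    have ht0 : t ≠ 0 := (ha.trans_le ht).ne'
    convert! (hasDerivAt_neg t).exp.mul (Real.hasDerivAt_log ht0) using 1
    ring
  have hlim : Tendsto (fun t : ℝ => Real.exp (-t) * Real.log t) atTop (𝓝 0) := by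
    have h := Real.tendsto_pow_mul_exp_neg_atTop_nhds_zero 1
    refine squeeze_zero' (g := fun t : ℝ => t ^ 1 * Real.exp (-t)) ?_ ?_ h
    · filter_upwards [eventually_ge_atTop 1] with t ht
      exact mul_nonneg (Real.exp_pos _).le (Real.log_nonneg ht)
    · filter_upwards [eventually_gt_atTop 0] with t ht
      rw [pow_one, mul_comm]
      have := Real.log_le_sub_one_of_pos ht
      gcongr
      linarith
  have h := integral_Ioi_of_hasDerivAt_of_tendsto' hd (i1.sub i2) hlim
  rw [integral_sub i1 i2] at h
  linarith

lemma tendsto_one_sub_exp_neg_mul_log :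
    Tendsto (fun a : ℝ => (1 - Real.exp (-a)) * Real.log a) (𝓝[>] 0) (𝓝 0) := by
  have h := (tendsto_log_mul_rpow_nhdsGT_zero one_pos).abs
  rw [abs_zero] at h
  refine squeeze_zero_norm' ?_ h
  filter_upwards [self_mem_nhdsWithin] with a (ha : 0 < a)
  have h1 : Real.exp (-a) ≤ 1 := Real.exp_le_one_iff.2 (by linarith)
  have h2 := Real.add_one_le_exp (-a)
  rw [Real.norm_eq_abs, abs_mul, abs_mul, Real.rpow_one, abs_of_nonneg (sub_nonneg.2 h1),
    abs_of_pos ha, mul_comm]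
  gcongr
  linarith

open MeasureTheory in
-- Both sides have the same derivative in `a`, hence differ by a constant `l`, found by letting the
-- endpoint tend to `0`.
lemma integral_exp_neg_div {a : ℝ} (ha : 0 < a) :
    ∫ t in Set.Ioi a, Real.exp (-t) / t = -expIntegralSeries (-a) := by
  have hd : ∀ u : ℝ, 0 < u →
      HasDerivAt (fun u => expIntegralSeries (-u)) (Real.exp (-u) / u) u := by
    intro u hu
    convert! (hasDerivAt_expIntegralSeries (neg_ne_zero.2 hu.ne')).comp u (hasDerivAt_neg u) using 1
    field_simp
  have hl := tendsto_limUnder_of_hasDerivAt_of_integrableOn_Ioi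
    (fun u (hu : u ∈ Set.Ioi a) => hd u (ha.trans hu)) (integrableOn_exp_neg_div ha)
  set l := limUnder atTop fun u => expIntegralSeries (-u)
  have key : ∀ b : ℝ, 0 < b →
      ∫ t in Set.Ioi b, Real.exp (-t) / t = l - expIntegralSeries (-b) := fun b hb =>
    integral_Ioi_of_hasDerivAt_of_tendsto' (fun u hu => hd u (hb.trans_le hu))
      (integrableOn_exp_neg_div hb) hl
  have hid : Tendsto (fun b : ℝ => b) (𝓝[>] 0) (𝓝 0) := tendsto_id.mono_left nhdsWithin_le_nhds
  have hI : Tendsto (fun b : ℝ => ∫ t in Set.Ioi b, Real.exp (-t) * Real.log t) (𝓝[>] 0)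
      (𝓝 (∫ t in Set.Ioi (0 : ℝ), Real.exp (-t) * Real.log t)) := by
    refine ((aecover_Ioi_of_Ioi hid).integral_tendsto_of_countably_generated
      integrableOn_exp_neg_mul_log).congr' ?_
    filter_upwards [self_mem_nhdsWithin] with b (hb : 0 < b)
    rw [Measure.restrict_restrict measurableSet_Ioi,
      Set.inter_eq_left.2 (Set.Ioi_subset_Ioi hb.le)]
  have hW : Tendsto (fun b => Real.exp (-b) * invGammaDerivSeries b) (𝓝[>] 0)
      (𝓝 (deriv invGamma 1)) := by
    have hc : Continuous fun b => Real.exp (-b) * invGammaDerivSeries b :=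
      (Real.continuous_exp.comp continuous_neg).mul continuous_invGammaDerivSeries
    have := hc.tendsto 0
    simp only [neg_zero, Real.exp_zero, one_mul, invGammaDerivSeries_zero] at this
    exact this.mono_left nhdsWithin_le_nhds
  -- After integration by parts the logarithms combine to `(1 - e^(-b)) log b → 0`, and `W(0) =
  -- (1/Γ)'(1)` cancels `∫ e^(-t) log t`.
  have hl0 : l = 0 := by
    have h := (tendsto_one_sub_exp_neg_mul_log.add hW).add hI
    rw [deriv_invGamma_one, zero_add, neg_add_cancel] at h
    refine tendsto_nhds_unique (tendsto_const_nhds.congr' ?_) h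
    filter_upwards [self_mem_nhdsWithin] with b (hb : 0 < b)
    have := key b hb
    rw [integral_exp_neg_div_by_parts hb, expIntegralSeries, neg_neg, Real.log_neg_eq_log] at this
    linear_combination -this
  rw [key a ha, hl0, zero_sub]

lemma integral_Iic_exp_div {a : ℝ} (ha : 0 < a) :
    ∫ t in Set.Iic (-a), Real.exp t / t = expIntegralSeries (-a) := by
  have h := integral_comp_neg_Iic (-a) fun t : ℝ => -(Real.exp (-t) / t)
  simp only [neg_neg, MeasureTheory.integral_neg, integral_exp_neg_div ha] at h
  rw [← h, ← MeasureTheory.integral_neg]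
  refine MeasureTheory.integral_congr_ae (Eventually.of_forall fun t => ?_)
  simp only [div_neg, neg_neg]

open MeasureTheory in
lemma integrableOn_Iic_exp_div {a : ℝ} (ha : 0 < a) :
    IntegrableOn (fun t => Real.exp t / t) (Set.Iic (-a)) := by
  refine Integrable.mono' ((integrableOn_exp_Iic (-a)).div_const a)
    (Measurable.aestronglyMeasurable (by fun_prop)) ?_
  filter_upwards [ae_restrict_mem measurableSet_Iic] with t (ht : t ≤ -a)
  rw [Real.norm_eq_abs, abs_div, abs_of_pos (Real.exp_pos _), abs_of_neg (by linarith)]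
  gcongr
  linarith

lemma expIntegralEi_of_neg {y : ℝ} (hy : y < 0) : expIntegralEi y = expIntegralSeries y := by
  refine Tendsto.limUnder_eq (tendsto_const_nhds.congr' ?_)
  have h : ∀ᶠ ε in 𝓝[>] (0 : ℝ), ε < -y :=
    nhdsWithin_le_nhds (Iio_mem_nhds (by linarith))
  filter_upwards [h] with ε hε
  have hs : Set.Iic y \ Set.Ioo (-ε) ε = Set.Iic (- -y) := by
    ext t
    simp only [Set.mem_sdiff, Set.mem_Iic, Set.mem_Ioo, neg_neg]
    exact ⟨fun h => h.1, fun h => ⟨h, fun h2 => by linarith [h2.1]⟩⟩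
  rw [hs, integral_Iic_exp_div (by linarith), neg_neg]

open MeasureTheory in
lemma expIntegralEi_of_pos {y : ℝ} (hy : 0 < y) : expIntegralEi y = expIntegralSeries y := by
  refine Tendsto.limUnder_eq ?_
  -- The symmetric cut makes `log |-ε|` and `log ε` cancel; what remains is continuous in `ε`.
  have hlim : Tendsto (fun ε => Real.exp (-ε) * invGammaDerivSeries ε -
      Real.exp ε * invGammaDerivSeries (-ε) + expIntegralSeries y) (𝓝[>] 0)
      (𝓝 (expIntegralSeries y)) := by
    have hW := continuous_invGammaDerivSeries
    have hc : Continuous fun ε => Real.exp (-ε) * invGammaDerivSeries ε -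
      Real.exp ε * invGammaDerivSeries (-ε) + expIntegralSeries y := by fun_prop
    have := hc.tendsto 0
    simp only [neg_zero, sub_self, zero_add] at this
    exact this.mono_left nhdsWithin_le_nhds
  refine hlim.congr' ?_
  have h : ∀ᶠ ε in 𝓝[>] (0 : ℝ), ε < y := nhdsWithin_le_nhds (Iio_mem_nhds hy)
  filter_upwards [h, self_mem_nhdsWithin] with ε hε (hε0 : 0 < ε)
  have hs : Set.Iic y \ Set.Ioo (-ε) ε = Set.Iic (-ε) ∪ Set.Icc ε y := by
    ext t
    simp only [Set.mem_sdiff, Set.mem_Iic, Set.mem_Ioo, Set.mem_union, Set.mem_Icc, not_and, not_lt]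
    constructor
    · rintro ⟨h1, h2⟩
      rcases le_or_gt t (-ε) with h | h
      · exact Or.inl h
      · exact Or.inr ⟨h2 h, h1⟩
    · rintro (h | ⟨h1, h2⟩)
      · exact ⟨by linarith, fun h2 => by linarith⟩
      · exact ⟨h2, fun _ => h1⟩
  have hc : ContinuousOn (fun t => Real.exp t / t) (Set.Icc ε y) :=
    Real.continuous_exp.continuousOn.div continuousOn_id fun t ht => (hε0.trans_le ht.1).ne'
  have hdisj : Disjoint (Set.Iic (-ε)) (Set.Icc ε y) :=
    Set.disjoint_left.2 fun t (h1 : t ≤ -ε) h2 => by linarith [h2.1]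
  rw [hs, setIntegral_union hdisj measurableSet_Icc (integrableOn_Iic_exp_div hε0)
    hc.integrableOn_Icc, integral_Iic_exp_div hε0, integral_Icc_eq_integral_Ioc,
    ← intervalIntegral.integral_of_le hε.le,
    intervalIntegral.integral_eq_sub_of_hasDerivAt (f := expIntegralSeries)]
  · rw [expIntegralSeries, expIntegralSeries, expIntegralSeries, neg_neg, Real.log_neg_eq_log]
    ring
  · intro t ht
    rw [Set.uIcc_of_le hε.le] at ht
    exact hasDerivAt_expIntegralSeries (hε0.trans_le ht.1).ne'
  · exact ContinuousOn.intervalIntegrable (by rwa [Set.uIcc_of_le hε.le])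

lemma expIntegralEi_eq {y : ℝ} (hy : y ≠ 0) : expIntegralEi y = expIntegralSeries y :=
  hy.lt_or_gt.elim expIntegralEi_of_neg expIntegralEi_of_pos

lemma hasDerivAt_expIntegralEi {y : ℝ} (hy : y ≠ 0) :
    HasDerivAt expIntegralEi (Real.exp y / y) y :=
  (hasDerivAt_expIntegralSeries hy).congr_of_eventuallyEq
    (by filter_upwards [isOpen_ne.mem_nhds hy] with z hz using expIntegralEi_eq hz)

/-! ### Recurrences for the finite sum of exponential integrals. -/

lemma sum_Icc_one_eq_sum_range (f : ℕ → ℝ) (n : ℕ) :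
    ∑ k ∈ Finset.Icc 1 n, f k = ∑ p ∈ Finset.range n, f (p + 1) := by
  induction n with
  | zero => simp
  | succ n ih => rw [Finset.sum_Icc_succ_top (by omega), ih, Finset.sum_range_succ]

/-- The polynomial part of `expIntegralTerm`. -/
def expIntegralPoly (p : ℕ) (x : ℝ) : ℝ :=
  ∑ i ∈ Finset.range p, (i.factorial : ℝ) * (1 + (-1) ^ (p + i)) * x ^ (p - 1 - i)

/-- The combination of exponential integrals of degree `p` entering the limit. -/
def expIntegralTerm (p : ℕ) (x : ℝ) : ℝ :=
  x ^ p * (Real.exp (-x) * expIntegralEi x + (-1) ^ (p + 1) * Real.exp x * expIntegralEi (-x)) -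
    expIntegralPoly p x

lemma hasDerivAt_expIntegralPoly (p : ℕ) {x : ℝ} (hx : x ≠ 0) :
    HasDerivAt (expIntegralPoly p)
      ((p * expIntegralPoly p x - expIntegralPoly (p + 1) x + x ^ p * (1 + (-1) ^ (p + 1))) / x)
      x := by
  have h : HasDerivAt (expIntegralPoly p)
      (∑ i ∈ Finset.range p, (i.factorial : ℝ) * (1 + (-1) ^ (p + i)) *
        (((p - 1 - i : ℕ) : ℝ) * x ^ (p - 1 - i - 1))) x :=
    HasDerivAt.fun_sum fun i _ => (hasDerivAt_pow (p - 1 - i) x).const_mul _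
  convert! h using 1
  rw [div_eq_iff hx, expIntegralPoly, expIntegralPoly, Finset.sum_range_succ', Finset.mul_sum,
    Finset.sum_mul, sub_add, add_sub_assoc]
  simp only [Nat.factorial_zero, Nat.cast_one, one_mul, add_zero, Nat.add_sub_cancel, Nat.sub_zero]
  rw [show (1 + (-1 : ℝ) ^ (p + 1)) * x ^ p - x ^ p * (1 + (-1) ^ (p + 1)) = 0 by ring, add_zero,
    ← Finset.sum_sub_distrib]
  refine Finset.sum_congr rfl fun i hi => ?_
  obtain ⟨q, rfl⟩ := Nat.exists_eq_add_of_lt (Finset.mem_range.1 hi)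
  rw [show i + q + 1 - 1 - i = q by omega, show i + q + 1 - (i + 1) = q by omega,
    Nat.factorial_succ]
  have hq : (q : ℝ) * x ^ (q - 1) * x = q * x ^ q := by
    rcases q with _ | q
    · simp
    · rw [Nat.add_sub_cancel, pow_succ]; ring
  push_cast
  rw [mul_assoc _ _ x, hq]
  ring

/-- Differentiation negates `e^(-x) Ei(x)` and preserves `e^x Ei(-x)`, which shifts the parity of
`p`; each also yields `1/x`, which the polynomial part is built to absorb. -/
lemma hasDerivAt_expIntegralTerm (p : ℕ) {x : ℝ} (hx : x ≠ 0) :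
    HasDerivAt (expIntegralTerm p) ((p * expIntegralTerm p x - expIntegralTerm (p + 1) x) / x)
      x := by
  have hP := (hasDerivAt_neg x).exp.mul (hasDerivAt_expIntegralEi hx)
  have hQ := ((Real.hasDerivAt_exp x).const_mul ((-1) ^ (p + 1))).mul
    ((hasDerivAt_expIntegralEi (neg_ne_zero.2 hx)).comp x (hasDerivAt_neg x))
  have h := ((hasDerivAt_pow p x).mul (hP.add hQ)).sub (hasDerivAt_expIntegralPoly p hx)
  convert! h using 1
  simp only [expIntegralTerm, Pi.add_apply, Pi.mul_apply, Function.comp_apply]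
  have hp : (p : ℝ) * x ^ (p - 1) = p * x ^ p / x := by
    rcases p with _ | p
    · simp
    · rw [Nat.add_sub_cancel, pow_succ]; field_simp
  rw [hp, Real.exp_neg]
  have := Real.exp_ne_zero x
  field_simp
  ring

/-- The coefficients of the combination of `expIntegralTerm`s in the limit. -/
def limitCoeff (m p : ℕ) : ℝ :=
  ((2 * m - p).choose m : ℝ) * ((2 : ℝ) ^ ((p : ℤ) - 2 * m - 1) / p.factorial)

/-- The combination of exponential integrals giving the limit at `n = m + 1`. -/
def limitSum (m : ℕ) (x : ℝ) : ℝ :=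
  ∑ p ∈ Finset.range (m + 1), limitCoeff m p * expIntegralTerm p x

/-- This Pascal-type rule is what lets the operator `2m + 1 - x d/dx` send `limitSum m` to a
multiple of `limitSum (m + 1)`. -/
lemma limitCoeff_succ (m p : ℕ) (hp : p ≤ m + 1) :
    2 * ((m : ℝ) + 1) * limitCoeff (m + 1) p =
      (if p ≤ m then (2 * m + 1 - p) * limitCoeff m p else 0) +
        (if p = 0 then 0 else limitCoeff m (p - 1)) := by
  have h2 : (2 : ℝ) ≠ 0 := two_ne_zero
  have e1 : ∀ p : ℕ, (2 : ℝ) ^ ((p : ℤ) - 2 * (m + 1 : ℕ) - 1) =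
      2 ^ ((p : ℤ) - 2 * m - 1) / 4 := fun p => by
    rw [show (p : ℤ) - 2 * (m + 1 : ℕ) - 1 = ((p : ℤ) - 2 * m - 1) - 2 by push_cast; ring,
      zpow_sub₀ h2]
    norm_num
  rcases hp.eq_or_lt with rfl | hp
  · rw [if_neg (by omega), if_neg (by omega), Nat.add_sub_cancel, limitCoeff, limitCoeff, e1,
      show 2 * (m + 1) - (m + 1) = m + 1 by omega, show 2 * m - m = m by omega, Nat.choose_self,
      Nat.choose_self, Nat.factorial_succ,
      show (((m + 1 : ℕ) : ℤ) - 2 * m - 1) = ((m : ℤ) - 2 * m - 1) + 1 by push_cast; ring,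
      zpow_add_one₀ h2]
    have : (m.factorial : ℝ) ≠ 0 := by positivity
    push_cast
    field_simp
    ring
  -- With `m = p + q`, `c1` and `c2` link the binomials of `limitCoeff (m + 1) p`, `limitCoeff m (p
  -- - 1)` and `limitCoeff m p`.
  · obtain ⟨q, rfl⟩ := Nat.exists_eq_add_of_le (Nat.le_of_lt_succ hp)
    rw [if_pos (by omega)]
    have c1 : ((p + q : ℕ) + 1 : ℝ) * (p + 2 * q + 2).choose (p + q + 1) =
        (p + 2 * q + 2) * (p + 2 * q + 1).choose (p + q) := by
      have := Nat.add_one_mul_choose_eq (p + 2 * q + 1) (p + q)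
      have h := congrArg (Nat.cast (R := ℝ)) this
      push_cast at h ⊢
      linarith
    have c2 : ((q : ℝ) + 1) * (p + 2 * q + 1).choose (p + q) =
        (p + 2 * q + 1) * (p + 2 * q).choose (p + q) := by
      have := Nat.choose_mul_succ_eq (p + 2 * q) (p + q)
      rw [show p + 2 * q + 1 - (p + q) = q + 1 by omega] at this
      have h := congrArg (Nat.cast (R := ℝ)) this
      push_cast at h ⊢
      linarith
    have hf : (p.factorial : ℝ) ≠ 0 := by positivity
    rw [limitCoeff, limitCoeff, e1, show 2 * (p + q + 1) - p = p + 2 * q + 2 by omega,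
      show 2 * (p + q) - p = p + 2 * q by omega]
    rcases p with _ | p
    · rw [if_pos rfl]
      generalize (2 : ℝ) ^ (((0 : ℕ) : ℤ) - 2 * (0 + q : ℕ) - 1) = w
      push_cast at c1 c2 ⊢
      linear_combination w * (1 / 2 * c1 + c2)
    · rw [if_neg (by omega), limitCoeff, Nat.add_sub_cancel,
        show 2 * (p + 1 + q) - p = p + 1 + 2 * q + 1 by omega,
        show (((p + 1 : ℕ) : ℤ) - 2 * (p + 1 + q : ℕ) - 1) =
          ((p : ℤ) - 2 * (p + 1 + q : ℕ) - 1) + 1 by push_cast; ring, zpow_add_one₀ h2,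
        Nat.factorial_succ]
      have hf : (p.factorial : ℝ) ≠ 0 := by positivity
      push_cast at c1 c2 ⊢
      field_simp
      linear_combination 4 * c1 + 8 * c2

lemma limitSum_succ (m : ℕ) (x : ℝ) :
    2 * ((m : ℝ) + 1) * limitSum (m + 1) x =
      ∑ p ∈ Finset.range (m + 1), limitCoeff m p *
        ((2 * m + 1 - p) * expIntegralTerm p x + expIntegralTerm (p + 1) x) := by
  rw [limitSum, Finset.mul_sum]
  have h : ∀ p ∈ Finset.range (m + 1 + 1),
      2 * ((m : ℝ) + 1) * (limitCoeff (m + 1) p * expIntegralTerm p x) =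
      (if p ≤ m then (2 * m + 1 - p) * limitCoeff m p else 0) * expIntegralTerm p x +
        (if p = 0 then 0 else limitCoeff m (p - 1)) * expIntegralTerm p x := fun p hp => by
    rw [← mul_assoc, limitCoeff_succ m p (by have := Finset.mem_range.1 hp; omega), add_mul]
  rw [Finset.sum_congr rfl h, Finset.sum_add_distrib, Finset.sum_range_succ,
    Finset.sum_range_succ' (n := m + 1), if_neg (by omega), if_pos rfl, zero_mul, zero_mul,
    add_zero, add_zero, ← Finset.sum_add_distrib]
  refine Finset.sum_congr rfl fun p hp => ?_
  rw [if_pos (by have := Finset.mem_range.1 hp; omega), if_neg (by omega), Nat.add_sub_cancel]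
  ring

lemma hasDerivAt_limitSum (m : ℕ) {x : ℝ} (hx : x ≠ 0) :
    HasDerivAt (limitSum m)
      (((2 * m + 1) * limitSum m x - 2 * (m + 1) * limitSum (m + 1) x) / x) x := by
  have h : HasDerivAt (limitSum m) (∑ p ∈ Finset.range (m + 1), limitCoeff m p *
      ((p * expIntegralTerm p x - expIntegralTerm (p + 1) x) / x)) x :=
    HasDerivAt.fun_sum fun p _ => (hasDerivAt_expIntegralTerm p hx).const_mul _
  convert! h using 1
  rw [limitSum_succ, limitSum, Finset.mul_sum, ← Finset.sum_sub_distrib, Finset.sum_div]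
  refine Finset.sum_congr rfl fun p _ => ?_
  ring

/-! ### Evaluation of the order derivative. -/

lemma hasSum_deriv_invGamma_odd (x : ℝ) :
    HasSum (fun k : ℕ => deriv invGamma (2 * k + 2) * x ^ (2 * k + 1))
      ((invGammaDerivSeries x - invGammaDerivSeries (-x)) / 2) := by
  have hs := summable_deriv_invGamma x
  obtain ⟨e, he⟩ := hs.comp_injective (i := fun k : ℕ => 2 * k) fun a b h => by simpa using h
  obtain ⟨o, ho⟩ := hs.comp_injective (i := fun k : ℕ => 2 * k + 1) fun a b h => by simpa using h
  simp only [Function.comp_def] at he ho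
  have he' := he
  have ho' := ho.neg
  simp only [← (even_two_mul _).neg_pow x] at he'
  simp only [← mul_neg, ← (odd_two_mul_add_one _).neg_pow x] at ho'
  have h1 := (HasSum.even_add_odd (f := fun k : ℕ => deriv invGamma (k + 1) * x ^ k) he ho).tsum_eq
  have h2 := (HasSum.even_add_odd (f := fun k : ℕ => deriv invGamma (k + 1) * (-x) ^ k)
    he' ho').tsum_eq
  rw [invGammaDerivSeries, invGammaDerivSeries, h1, h2, add_sub_add_left_eq_sub, sub_neg_eq_add,
    add_self_div_two]
  refine ho.congr_fun fun k => ?_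
  push_cast
  rw [show (2 * k + 1 + 1 : ℝ) = 2 * k + 2 by ring]

lemma deriv_invGamma_duplication (s : ℝ) :
    deriv invGamma s * invGamma (s + 1 / 2) + invGamma s * deriv invGamma (s + 1 / 2) =
      2 * ((2 : ℝ) ^ (2 * s - 1) / √Real.pi) *
        (deriv invGamma (2 * s) + Real.log 2 * invGamma (2 * s)) := by
  have h1 := (hasDerivAt_invGamma s).mul
    ((hasDerivAt_invGamma (s + 1 / 2)).comp_add_const s (1 / 2))
  have hl : HasDerivAt (fun s : ℝ => 2 * s) (2 * 1) s := (hasDerivAt_id s).const_mul 2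
  have h2 := ((hasDerivAt_invGamma (2 * s)).comp s hl).mul
    (((hl.sub_const 1).const_rpow two_pos).div_const (√Real.pi))
  have h3 := h2.congr_of_eventuallyEq (Eventually.of_forall invGamma_mul_invGamma_add_half)
  rw [h1.unique h3, Function.comp_apply]
  ring

lemma orderDerivFactor_zero {z : ℝ} (hz : 0 < z) :
    orderDerivFactor 0 (z ^ 2) = -(2 / √Real.pi) * limitSum 0 (2 * z) / z := by
  have hx : (2 * z) ≠ 0 := by positivity
  have hpow : ∀ k : ℕ, (2 : ℝ) ^ (2 * ((k : ℝ) + 1) - 1) = 2 ^ (2 * k + 1) := fun k => by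
    rw [← Real.rpow_natCast]; congr 1; push_cast; ring
  have hg : ∀ k : ℕ, invGamma (2 * ((k : ℝ) + 1)) = ((2 * k + 1).factorial : ℝ)⁻¹ := fun k => by
    rw [← invGamma_natCast_add_one]; congr 1; push_cast; ring
  have e1 : ∑' k, besselCoeff invGamma 1 k * (z ^ 2) ^ k =
      Real.sinh (2 * z) / (√Real.pi * z) := by
    rw [← (Real.hasSum_sinh (2 * z)).tsum_eq, ← tsum_div_const]
    refine tsum_congr fun k => ?_
    have h := invGamma_mul_invGamma_add_half ((k : ℝ) + 1)
    rw [invGamma_natCast_add_one, hpow, hg, show (k : ℝ) + 1 + 1 / 2 = 1 + k + 1 / 2 by ring] at h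
    rw [besselCoeff, div_eq_inv_mul, h, mul_pow, ← pow_mul, pow_succ z]
    field_simp
  have e2 : (∑' k, besselCoeff (deriv invGamma) 1 k * (z ^ 2) ^ k) +
      (∑' k, struveCoeff (deriv invGamma) 1 k * (z ^ 2) ^ k) =
      2 / (√Real.pi * z) * ((invGammaDerivSeries (2 * z) - invGammaDerivSeries (-(2 * z))) / 2 +
        Real.log 2 * Real.sinh (2 * z)) := by
    rw [← ((hasSum_deriv_invGamma_odd (2 * z)).add
      ((Real.hasSum_sinh (2 * z)).mul_left (Real.log 2))).tsum_eq, ← tsum_mul_left,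
      ← ((factorialBounded_besselCoeff_deriv 1).summable _).tsum_add
        ((factorialBounded_struveCoeff_deriv 1).summable _)]
    -- The two `k`-th coefficients are the two halves of the product rule for `1/(Γ(s) Γ(s + 1/2))`
    -- at `s = k + 1`.
    refine tsum_congr fun k => ?_
    have h := deriv_invGamma_duplication ((k : ℝ) + 1)
    rw [invGamma_natCast_add_one, hpow, hg,
      show 2 * ((k : ℝ) + 1) = 2 * k + 2 by ring] at h
    rw [besselCoeff, struveCoeff, ← add_mul, div_eq_inv_mul,
      show (1 : ℝ) + k + 1 / 2 = k + 1 + 1 / 2 by ring,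
      show (k : ℝ) + 3 / 2 = k + 1 + 1 / 2 by ring, show (k : ℝ) + 2 - 1 = k + 1 by ring,
      add_comm, mul_comm (invGamma _), h, mul_pow, ← pow_mul, pow_succ z]
    field_simp
  have hlog : Real.log (2 * z) = Real.log 2 + Real.log z := Real.log_mul two_ne_zero hz.ne'
  have e3 : limitSum 0 (2 * z) = -(Real.sinh (2 * z) * Real.log (2 * z)) -
      (invGammaDerivSeries (2 * z) - invGammaDerivSeries (-(2 * z))) / 2 := by
    simp only [limitSum, zero_add, Finset.sum_range_one, limitCoeff, expIntegralTerm,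
      expIntegralPoly, Finset.sum_range_zero, expIntegralEi_eq hx,
      expIntegralEi_eq (neg_ne_zero.2 hx), expIntegralSeries, neg_neg, Real.log_neg_eq_log,
      Real.sinh_eq, Real.exp_neg]
    have := Real.exp_ne_zero (2 * z)
    norm_num
    field_simp
    ring
  rw [orderDerivFactor, Nat.cast_zero, zero_add, pow_zero, div_one, add_assoc, e2, e1, e3, hlog,
    Real.log_pow]
  have : √Real.pi ≠ 0 := by positivity
  push_cast
  field_simp
  ring

/-- In the inductive step, differentiating `z^(-(2m+1))` cancels the `(2m + 1)` term of
`hasDerivAt_limitSum`; the surviving `-2(m + 1)` supplies the next sign and factorial. -/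
lemma orderDerivFactor_eq (m : ℕ) {z : ℝ} (hz : 0 < z) :
    orderDerivFactor m (z ^ 2) =
      (-1) ^ (m + 1) * (2 / √Real.pi) * m.factorial * limitSum m (2 * z) / z ^ (2 * m + 1) := by
  induction m generalizing z with
  | zero => rw [orderDerivFactor_zero hz]; simp
  | succ m ih =>
    have h1 := HasDerivAt.comp (h := fun z => z ^ 2) z
      (hasDerivAt_orderDerivFactor m (pow_ne_zero 2 hz.ne')) (hasDerivAt_pow 2 z)
    have h2 := ((((hasDerivAt_limitSum m (by positivity : 2 * z ≠ 0)).comp z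
      ((hasDerivAt_id z).const_mul 2)).const_mul
      ((-1) ^ (m + 1) * (2 / √Real.pi) * m.factorial)).div
      (hasDerivAt_pow (2 * m + 1) z) (by positivity))
    have h3 := h2.congr_of_eventuallyEq (f₁ := orderDerivFactor m ∘ fun z => z ^ 2)
      (by filter_upwards [lt_mem_nhds hz] with y hy using ih hy)
    have h4 := h1.unique h3
    simp only [Function.comp_apply, Nat.add_sub_cancel] at h4
    have hz0 := hz.ne'
    have hpi : √Real.pi ≠ 0 := by positivity
    -- The factor `2z` is the chain-rule derivative of `t = z^2`.
    rw [← mul_left_inj' (show ((2 : ℕ) : ℝ) * z ^ (2 - 1) ≠ 0 by simp [hz0]), h4,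
      Nat.factorial_succ]
    push_cast
    field_simp
    ring

lemma limitSum_eq_sum_Icc (m : ℕ) (x : ℝ) :
    limitSum m x = ∑ k ∈ Finset.Icc 1 (m + 1),
      ((2 * (m + 1) - k - 1).choose (m + 1 - 1) : ℝ) *
        ((2 : ℝ) ^ ((k : ℤ) - 2 * ((m + 1 : ℕ) : ℤ)) / ((k - 1).factorial : ℝ)) *
        (x ^ (k - 1) *
            (Real.exp (-x) * expIntegralEi x + (-1) ^ k * Real.exp x * expIntegralEi (-x)) -
          ∑ j ∈ Finset.Icc 1 (k - 1),
            ((j - 1).factorial : ℝ) * (1 + (-1) ^ (k + j)) * x ^ (k - j - 1)) := by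
  rw [sum_Icc_one_eq_sum_range, limitSum]
  refine Finset.sum_congr rfl fun p _ => ?_
  rw [sum_Icc_one_eq_sum_range, limitCoeff, expIntegralTerm, expIntegralPoly,
    show 2 * (m + 1) - (p + 1) - 1 = 2 * m - p by omega]
  simp only [Nat.add_sub_cancel]
  rw [show ((p + 1 : ℕ) : ℤ) - 2 * ((m + 1 : ℕ) : ℤ) = (p : ℤ) - 2 * m - 1 by push_cast; ring]
  congr 2
  refine Finset.sum_congr rfl fun i _ => ?_
  rw [show p + 1 - (i + 1) - 1 = p - 1 - i by omega, show p + 1 + (i + 1) = p + i + 2 by ring,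
    pow_add _ _ 2, neg_one_sq, mul_one]

/-! ### Passage to the limit. -/

lemma tendsto_div_of_hasDerivAt {f g : ℝ → ℝ} {f' g' a : ℝ} (hf : HasDerivAt f f' a)
    (hg : HasDerivAt g g' a) (hfa : f a = 0) (hga : g a = 0) (hg' : g' ≠ 0) :
    Tendsto (fun y => f y / g y) (𝓝[≠] a) (𝓝 (f' / g')) := by
  refine ((hasDerivAt_iff_tendsto_slope.1 hf).div (hasDerivAt_iff_tendsto_slope.1 hg)
    hg').congr' ?_
  filter_upwards [self_mem_nhdsWithin] with y hy
  rw [Pi.div_apply, slope_def_field, slope_def_field, hfa, hga, sub_zero, sub_zero,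
    div_div_div_cancel_right₀ (sub_ne_zero.2 hy)]

end

theorem mainTheorem3 (x : ℝ) (hx : 0 < x) (n : ℕ) (hn : 1 ≤ n) :
    Tendsto
      (fun ν : ℝ => (modBesselI (ν - 1 / 2) x - modStruveL (1 / 2 - ν) x) / Real.sin (Real.pi * ν))
      (𝓝[≠] (n : ℝ))
      (𝓝 (2 / Real.pi ^ (3 / 2 : ℝ) * ((n - 1).factorial : ℝ) * (2 / x) ^ ((n : ℝ) - 1 / 2) *
        ∑ k ∈ Finset.Icc 1 n,
          ((2 * n - k - 1).choose (n - 1) : ℝ) *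
            ((2 : ℝ) ^ ((k : ℤ) - 2 * (n : ℤ)) / ((k - 1).factorial : ℝ)) *
            (x ^ (k - 1) *
                (Real.exp (-x) * expIntegralEi x + (-1) ^ k * Real.exp x * expIntegralEi (-x)) -
              ∑ j ∈ Finset.Icc 1 (k - 1),
                ((j - 1).factorial : ℝ) * (1 + (-1) ^ (k + j)) * x ^ (k - j - 1)))) := by
  obtain ⟨m, rfl⟩ := Nat.exists_eq_add_of_le' hn
  rw [← limitSum_eq_sum_Icc]
  have hz : 0 < x / 2 := by positivity
  have hsin : HasDerivAt (fun ν : ℝ => Real.sin (Real.pi * ν)) (Real.pi * (-1) ^ (m + 1))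
      ((m : ℝ) + 1) := by
    convert! ((hasDerivAt_id ((m : ℝ) + 1)).const_mul Real.pi).sin using 1
    have h := Real.cos_nat_mul_pi (m + 1)
    push_cast at h
    rw [id, mul_comm Real.pi ((m : ℝ) + 1), h]
    ring
  have hsin0 : Real.sin (Real.pi * ((m : ℝ) + 1)) = 0 := by
    have h := Real.sin_nat_mul_pi (m + 1)
    rw [mul_comm]
    exact_mod_cast h
  have key := tendsto_div_of_hasDerivAt (hasDerivAt_order_sub m hx) hsin
    (sub_eq_zero.2 (modBesselI_eq_modStruveL m hx)) hsin0
    (mul_ne_zero Real.pi_ne_zero (pow_ne_zero _ (by norm_num)))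
  push_cast
  convert! key using 2
  -- The prefactor `z^(m+1/2)` over `z^(2m+1)` leaves `(2/x)^(n-1/2)`; the sign `(-1)^(m+1)` cancels
  -- against the derivative of the sine.
  have h1 : (2 / x) ^ ((m : ℝ) + 1 - 1 / 2) = ((x / 2) ^ (m + 1 / 2 : ℝ))⁻¹ := by
    rw [← Real.inv_rpow hz.le, inv_div]; congr 1; ring
  have h2 : (x / 2) ^ (2 * m + 1) = (x / 2) ^ (m + 1 / 2 : ℝ) * (x / 2) ^ (m + 1 / 2 : ℝ) := by
    rw [← Real.rpow_add hz, ← Real.rpow_natCast]; congr 1; push_cast; ring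
  have h3 : Real.pi ^ (3 / 2 : ℝ) = Real.pi * √Real.pi := by
    rw [Real.sqrt_eq_rpow, ← Real.rpow_one_add' Real.pi_pos.le (by norm_num)]; norm_num
  have h4 : (x / 2) ^ (m + 1 / 2 : ℝ) ≠ 0 := (Real.rpow_pos_of_pos hz _).ne'
  rw [orderDerivFactor_eq m hz, h1, h2, h3,
    show 2 * (x / 2) = x by ring]
  have hpi : √Real.pi ≠ 0 := by positivity
  have hneg : ((-1 : ℝ)) ^ (m + 1) ≠ 0 := pow_ne_zero _ (by norm_num)
  field_simp
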